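/- All graphs are undirected and simple. A \emph{hole} is an induced cycle of length at least $4$. Consider the following graphs. \begin{itemize} \item The \emph{long claw}: the $7$-vertex tree obtained from the claw $K_{1,3}$ by subdividing each edge once. \item The \emph{whipping top}: a path $v_1v_2v_3v_4v_5$, a vertex adjacent to all of $v_1,\dots,v_5$, and a vertex adjacent only to $v_3$. \item The \emph{$\dagger$-AW with $d$ base vertices} ($d\ge 2$): vertices $s,c,b_0,\dots,b_{d+1}$ and edges $sc$, $b_ib_{i+1}$ for $0\le i\le d$, and $cb_i$ for $1\le i\le d$. \item The \emph{$\ddagger$-AW with $d$ base vertices} ($d\ge 1$): vertices $s,c_1,c_2,b_0,\dots,b_{d+1}$ and edges $sc_1$, $sc_2$, $c_1c_2$, $b_ib_{i+1}$ for $0\le i\le d$, $c_1b_i$ for $0\le i\le d$, and $c_2b_i$ for $1\le i\le d+1$. \end{itemize} The long claw, the whipping top, and the $\dagger$- and $\ddagger$-AWs with $d\le 3$ are the \emph{small} asteroidal witnesses; the $\dagger$- and $\ddagger$-AWs with $d>3$ are the \emph{long} ones, and the vertex $s$ of a long one is its \emph{shallow terminal}. A graph is \emph{reduced} if it contains no hole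 and no small asteroidal witness as an induced subgraph. For a reduced graph $G$, let $ST(G)$ be the set of shallow terminals of all long asteroidal witnesses that are induced subgraphs of $G$. A vertex set $M$ is a \emph{module} of $G$ if all vertices of $M$ have the same neighbors outside $M$; it is a \emph{simplicial module} if it is a module, $G[M]$ is connected, and the set $N(M)$ of vertices outside $M$ with a neighbor in $M$ is a clique. \textbf{Theorem.} Let $G$ be a reduced graph. The vertex set of every connected component of $G[ST(G)]$ is a simplicial module of $G$. -/

import Mathlib

open scoped SimpleGraph

namespace IntervalCompletion

/-- The long claw: the claw with center `0` and leaves `1, 2, 3`, each of whose edges is subdivided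
once more outwards, giving the terminals `4, 5, 6`. -/
def longClaw : SimpleGraph (Fin 7) :=
  SimpleGraph.fromEdgeSet {s(0, 1), s(0, 2), s(0, 3), s(1, 4), s(2, 5), s(3, 6)}

/-- The whipping top: an induced path `0 1 2 3 4`, a vertex `5` adjacent to all of the path, and a
vertex `6` adjacent only to the middle vertex `2` of the path. -/
def whippingTop : SimpleGraph (Fin 7) :=
  SimpleGraph.fromEdgeSet {s(0, 1), s(1, 2), s(2, 3), s(3, 4),
    s(5, 0), s(5, 1), s(5, 2), s(5, 3), s(5, 4), s(6, 2)}

/-- Vertices of the †-graph: the shallow terminal `s`, the center `c`, and the path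
`b 0, b 1, ..., b (d + 1)`, whose ends are the base terminals and whose inner vertices
`b 1, ..., b d` are the base. -/
inductive DagVertex (d : ℕ) : Type
  | s : DagVertex d
  | c : DagVertex d
  | b : Fin (d + 2) → DagVertex d

/-- Edges of the †-graph, each listed in one direction. -/
def DagVertex.rel {d : ℕ} : DagVertex d → DagVertex d → Prop
  | .s, .c => True
  | .c, .b i => 1 ≤ i.val ∧ i.val ≤ d
  | .b i, .b j => i.val + 1 = j.val
  | _, _ => False

/-- The †-graph with `d` base vertices; for `d ≥ 2` it is the †-asteroidal witness. -/
def dagGraph (d : ℕ) : SimpleGraph (DagVertex d) :=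
  SimpleGraph.fromRel DagVertex.rel

/-- Vertices of the ‡-graph: the shallow terminal `s`, the centers `c₁, c₂`, and the path
`b 0, b 1, ..., b (d + 1)`, whose ends are the base terminals and whose inner vertices
`b 1, ..., b d` are the base. -/
inductive DDagVertex (d : ℕ) : Type
  | s : DDagVertex d
  | c₁ : DDagVertex d
  | c₂ : DDagVertex d
  | b : Fin (d + 2) → DDagVertex d

/-- Edges of the ‡-graph, each listed in one direction: besides the base, `c₁` sees the left base
terminal `b 0` and `c₂` the right one `b (d + 1)`. -/
def DDagVertex.rel {d : ℕ} : DDagVertex d → DDagVertex d → Prop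
  | .s, .c₁ => True
  | .s, .c₂ => True
  | .c₁, .c₂ => True
  | .c₁, .b i => i.val ≤ d
  | .c₂, .b i => 1 ≤ i.val
  | .b i, .b j => i.val + 1 = j.val
  | _, _ => False

/-- The ‡-graph with `d` base vertices; for `d ≥ 1` it is the ‡-asteroidal witness. -/
def ddagGraph (d : ℕ) : SimpleGraph (DDagVertex d) :=
  SimpleGraph.fromRel DDagVertex.rel

variable {V : Type*}

/-- `G` has a hole: an induced cycle of length at least 4. -/
def HasHole (G : SimpleGraph V) : Prop :=
  ∃ n : ℕ, 4 ≤ n ∧ SimpleGraph.cycleGraph n ⊴ G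

/-- `G` has a small asteroidal witness as an induced subgraph: a long claw, a whipping top, or a
†- or ‡-asteroidal witness with at most 3 base vertices. -/
def HasSmallAW (G : SimpleGraph V) : Prop :=
  longClaw ⊴ G ∨ whippingTop ⊴ G ∨
    (∃ d : ℕ, 2 ≤ d ∧ d ≤ 3 ∧ dagGraph d ⊴ G) ∨
    (∃ d : ℕ, 1 ≤ d ∧ d ≤ 3 ∧ ddagGraph d ⊴ G)

/-- `G` is reduced: no hole and no small asteroidal witness. -/
def IsReduced (G : SimpleGraph V) : Prop :=
  ¬ HasHole G ∧ ¬ HasSmallAW G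

/-- `ST(G)`: the shallow terminals of the long asteroidal witnesses of `G`, that is, of the induced
†- and ‡-subgraphs with more than 3 base vertices. -/
def shallowTerminals (G : SimpleGraph V) : Set V :=
  {v | ∃ d : ℕ, 3 < d ∧
    ((∃ f : dagGraph d ↪g G, f DagVertex.s = v) ∨
      (∃ f : ddagGraph d ↪g G, f DDagVertex.s = v))}

/-- The neighborhood `N(M)` of a vertex set: vertices outside `M` with a neighbor in `M`. -/
def nbhd (G : SimpleGraph V) (M : Set V) : Set V :=
  {x | x ∉ M ∧ ∃ u ∈ M, G.Adj u x}

/-- `M` is a module: all its vertices have the same neighbors outside `M`. -/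
def IsModule (G : SimpleGraph V) (M : Set V) : Prop :=
  ∀ u ∈ M, ∀ v ∈ M, ∀ x ∉ M, (G.Adj u x ↔ G.Adj v x)

/-- `M` is a simplicial module: a module inducing a connected subgraph, with `N(M)` a clique. -/
def IsSimplicialModule (G : SimpleGraph V) (M : Set V) : Prop :=
  IsModule G M ∧ (G.induce M).Connected ∧ G.IsClique (nbhd G M)

end IntervalCompletion

/-! Fix a shallow terminal s, choose a long witness at s with as few base vertices as possible, and
let A be the set of vertices reachable from s through vertices with no neighbor in the base. Each
vertex of A can take the place of s (`IsAW.replace_terminal`), so A consists of shallow terminals. A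
neighbor of A outside A sees a base vertex, hence all of them: seeing only a part would yield a
witness with a shorter base inside the old one (`IsAW.exists_shorter`), which can be moved back to s
(`IsAW.transfer`). A vertex seeing the whole base sees all or nothing of A
(`IsAW.adj_of_base_full`), so A is a module. Two nonadjacent vertices of N(A) would form a hole with
s and a base vertex, so N(A) is a clique.

Components are then controlled by these modules. Let u, v be adjacent shallow terminals with modules
A, B. If v ∉ A, then v sees a base vertex z that u misses; u ∉ B would force u to see z, because B
is a module and N(B) a clique. So v ∈ A or u ∈ B, and u, v have the same neighbors outside their
component. Walks spread this over the component, whose neighborhood lies in N(A) for any of its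
vertices. -/

namespace IntervalCompletion

variable {V : Type*} {G : SimpleGraph V}

/-! ### Holes and small forbidden subgraphs -/

/-- A map preserving and reflecting adjacency out of a graph without twins is an induced
embedding. -/
theorem isIndContained_of_adj_iff {W : Type*} {H : SimpleGraph W} (f : W → V)
    (hf : ∀ i j, G.Adj (f i) (f j) ↔ H.Adj i j)
    (htwin : ∀ i j, (∀ k, H.Adj i k ↔ H.Adj j k) → i = j) : H ⊴ G :=
  -- Vertices with equal images have equal neighborhoods, so twin-freeness gives injectivity.
  ⟨⟨⟨f, fun i j hij => htwin i j fun k => by rw [← hf, ← hf, hij]⟩, fun {i j} => hf i j⟩⟩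

theorem cycleGraph_adj_iff {n : ℕ} (i j : Fin (n + 2)) :
    (SimpleGraph.cycleGraph (n + 2)).Adj i j ↔ i.val + 1 = j ∨ j.val + 1 = i ∨
      (i.val = 0 ∧ j.val = n + 1) ∨ (j.val = 0 ∧ i.val = n + 1) := by
  rw [SimpleGraph.cycleGraph_adj']
  have hi := i.isLt
  have hj := j.isLt
  rcases lt_trichotomy i j with hij | rfl | hij
  · rw [Fin.coe_sub_iff_lt.2 hij, Fin.sub_val_of_le hij.le]
    have : i.val < j := hij
    omega
  · rw [sub_self, Fin.val_zero]; omega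
  · rw [Fin.coe_sub_iff_lt.2 hij, Fin.sub_val_of_le hij.le]
    have : j.val < i := hij
    omega

/-- A vertex that sees exactly the two ends of an induced path closes a hole. -/
theorem hasHole_of_path {n : ℕ} (hn : 2 ≤ n) {b : ℕ → V} {y : V}
    (inj : ∀ i j, i ≤ n → j ≤ n → b i = b j → i = j)
    (path : ∀ i j, i ≤ n → j ≤ n → (G.Adj (b i) (b j) ↔ i + 1 = j ∨ j + 1 = i))
    (hy : ∀ i ≤ n, y ≠ b i) (hadj : ∀ i ≤ n, (G.Adj y (b i) ↔ i = 0 ∨ i = n)) : HasHole G := by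
  let f : Fin (n + 2) → V := fun i => if i.val = n + 1 then y else b i.val
  have hf : Function.Injective f := by
    rintro ⟨i, hi⟩ ⟨j, hj⟩ h
    simp only [Fin.mk.injEq, f] at h ⊢
    split_ifs at h with h1 h2 h2
    · omega
    · exact (hy j (by omega) h).elim
    · exact (hy i (by omega) h.symm).elim
    · exact inj i j (by omega) (by omega) h
  refine ⟨n + 2, by omega, ⟨⟨⟨f, hf⟩, ?_⟩⟩⟩
  rintro ⟨i, hi⟩ ⟨j, hj⟩
  rw [cycleGraph_adj_iff]
  change G.Adj (if i = n + 1 then y else b i) (if j = n + 1 then y else b j) ↔ _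
  simp only
  split_ifs with h1 h2 h2
  · simp; omega
  · rw [hadj j (by omega)]; omega
  · rw [G.adj_comm, hadj i (by omega)]; omega
  · rw [path i j (by omega) (by omega)]; omega

theorem IsReduced.adj_of_four_cycle (hG : IsReduced G) {a b c d : V} (hab : G.Adj a b)
    (hbc : G.Adj b c) (hcd : G.Adj c d) (hda : G.Adj d a) (hac : a ≠ c) (hbd : b ≠ d)
    (h : ¬ G.Adj a c) : G.Adj b d := by
  by_contra hbd'
  have h1 := hab.ne
  have h2 := hbc.ne
  refine hG.1 (hasHole_of_path (n := 2) (b := fun i => if i = 0 then a else if i = 1 then b else c)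
    (y := d) le_rfl ?_ ?_ ?_ ?_)
  · intro i j hi hj
    interval_cases i <;> interval_cases j <;> simp [*, eq_comm]
  · intro i j hi hj
    interval_cases i <;> interval_cases j <;> simp [*, G.adj_comm]
  · intro i hi
    interval_cases i <;> simp [hda.ne, hcd.ne.symm, hbd.symm]
  · intro i hi
    interval_cases i <;> simp [*, G.adj_comm, hda.symm]

theorem IsReduced.no_five_cycle (hG : IsReduced G) {a b c d e : V} (hab : G.Adj a b)
    (hbc : G.Adj b c) (hcd : G.Adj c d) (hde : G.Adj d e) (hea : G.Adj e a)
    (h1 : ¬ G.Adj a c) (h2 : ¬ G.Adj a d) (h3 : ¬ G.Adj b d) (h4 : ¬ G.Adj b e)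
    (h5 : ¬ G.Adj c e) : False := by
  have n1 := hab.ne
  have n2 := hbc.ne
  have n3 := hcd.ne
  have n4 : a ≠ c := by rintro rfl; exact h2 hcd
  have n5 : a ≠ d := by rintro rfl; exact h1 hcd.symm
  have n6 : b ≠ d := by rintro rfl; exact h2 hab
  have n7 : e ≠ b := by rintro rfl; exact h5 hbc.symm
  have n8 : e ≠ c := by rintro rfl; exact h4 hbc
  refine hG.1 (hasHole_of_path (n := 3)
    (b := fun i => if i = 0 then a else if i = 1 then b else if i = 2 then c else d)
    (y := e) (by norm_num) ?_ ?_ ?_ ?_)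
  · intro i j hi hj
    interval_cases i <;> interval_cases j <;> simp [*, eq_comm]
  · intro i j hi hj
    interval_cases i <;> interval_cases j <;> simp [*, G.adj_comm]
  · intro i hi
    interval_cases i <;> simp [hde.ne.symm, hea.ne, *]
  · intro i hi
    interval_cases i <;> simp [*, G.adj_comm, hea.symm]

/-- In a reduced graph, the neighbors of a vertex on an induced path are consecutive. -/
theorem IsReduced.adj_between (hG : IsReduced G) {n : ℕ} {b : ℕ → V} {y : V}
    (inj : ∀ i j, i ≤ n → j ≤ n → b i = b j → i = j)
    (path : ∀ i j, i ≤ n → j ≤ n → (G.Adj (b i) (b j) ↔ i + 1 = j ∨ j + 1 = i))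
    (hy : ∀ i ≤ n, y ≠ b i) {i m j : ℕ} (him : i ≤ m) (hmj : m ≤ j) (hj : j ≤ n)
    (hyi : G.Adj y (b i)) (hyj : G.Adj y (b j)) : G.Adj y (b m) := by
  classical
  by_contra hm
  -- With `p` the last neighbor index before `m` and `q` the first one after it, `y` closes the path
  -- from `b p` to `b q` into a hole.
  have hlast := Nat.findGreatest_spec (P := fun k => G.Adj y (b k)) him hyi
  have hlast_le := Nat.findGreatest_le (P := fun k => G.Adj y (b k)) m
  have hlast_max : ∀ k, Nat.findGreatest (fun k => G.Adj y (b k)) m < k → k ≤ m →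
    ¬ G.Adj y (b k) := fun k h1 h2 => Nat.findGreatest_is_greatest h1 h2
  generalize Nat.findGreatest (fun k => G.Adj y (b k)) m = p at hlast hlast_le hlast_max
  have hex : ∃ k, m ≤ k ∧ G.Adj y (b k) := ⟨j, hmj, hyj⟩
  have hfirst := Nat.find_spec hex
  have hfirst_le : Nat.find hex ≤ j := Nat.find_min' hex ⟨hmj, hyj⟩
  have hfirst_min : ∀ k, m ≤ k → k < Nat.find hex → ¬ G.Adj y (b k) :=
    fun k h1 h2 h3 => Nat.find_min hex h2 ⟨h1, h3⟩
  generalize Nat.find hex = q at hfirst hfirst_le hfirst_min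
  have hpm : p ≠ m := by rintro rfl; exact hm hlast
  have hqm : q ≠ m := by rintro rfl; exact hm hfirst.2
  have hmq := hfirst.1
  refine hG.1 (hasHole_of_path (n := q - p) (b := fun k => b (p + k)) (y := y) (by omega)
    ?_ ?_ ?_ ?_)
  · intro k l hk hl h
    have := inj _ _ (by omega) (by omega) h
    omega
  · intro k l hk hl
    rw [path _ _ (by omega) (by omega)]
    omega
  · intro k hk
    exact hy _ (by omega)
  · intro k hk
    constructor
    · intro h
      by_contra hne
      rcases le_total (p + k) m with hkm | hkm
      · exact hlast_max (p + k) (by omega) hkm h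
      · exact hfirst_min (p + k) hkm (by omega) h
    · rintro (rfl | rfl)
      · exact hlast
      · rw [show p + (q - p) = q by omega]
        exact hfirst.2

theorem IsReduced.no_longClaw (hG : IsReduced G) {c a₁ a₂ a₃ e₁ e₂ e₃ : V}
    (h1 : G.Adj c a₁) (h2 : G.Adj c a₂) (h3 : G.Adj c a₃)
    (h4 : G.Adj a₁ e₁) (h5 : G.Adj a₂ e₂) (h6 : G.Adj a₃ e₃)
    (n1 : ¬ G.Adj c e₁) (n2 : ¬ G.Adj c e₂) (n3 : ¬ G.Adj c e₃)
    (n4 : ¬ G.Adj a₁ a₂) (n5 : ¬ G.Adj a₁ a₃) (n6 : ¬ G.Adj a₂ a₃)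
    (n7 : ¬ G.Adj a₁ e₂) (n8 : ¬ G.Adj a₁ e₃) (n9 : ¬ G.Adj a₂ e₁) (n10 : ¬ G.Adj a₂ e₃)
    (n11 : ¬ G.Adj a₃ e₁) (n12 : ¬ G.Adj a₃ e₂)
    (n13 : ¬ G.Adj e₁ e₂) (n14 : ¬ G.Adj e₁ e₃) (n15 : ¬ G.Adj e₂ e₃) : False := by
  refine hG.2 (.inl (isIndContained_of_adj_iff ![c, a₁, a₂, a₃, e₁, e₂, e₃] ?_ ?_))
  · intro i j
    fin_cases i <;> fin_cases j <;>
      simp [longClaw, *, G.adj_comm]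
  · simp only [longClaw, SimpleGraph.fromEdgeSet_adj, Set.mem_insert_iff, Set.mem_singleton_iff]
    decide

/-- The whipping top with path `v₁ v₂ v₃ v₄ v₅`, dominating vertex `u` and pendant vertex `w`. -/
theorem IsReduced.no_whippingTop (hG : IsReduced G) {w u v₁ v₂ v₃ v₄ v₅ : V}
    (h1 : G.Adj v₁ v₂) (h2 : G.Adj v₂ v₃) (h3 : G.Adj v₃ v₄) (h4 : G.Adj v₄ v₅)
    (u1 : G.Adj u v₁) (u2 : G.Adj u v₂) (u3 : G.Adj u v₃) (u4 : G.Adj u v₄) (u5 : G.Adj u v₅)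
    (w3 : G.Adj w v₃)
    (n13 : ¬ G.Adj v₁ v₃) (n14 : ¬ G.Adj v₁ v₄) (n15 : ¬ G.Adj v₁ v₅) (n24 : ¬ G.Adj v₂ v₄)
    (n25 : ¬ G.Adj v₂ v₅) (n35 : ¬ G.Adj v₃ v₅)
    (w1 : ¬ G.Adj w v₁) (w2 : ¬ G.Adj w v₂) (w4 : ¬ G.Adj w v₄) (w5 : ¬ G.Adj w v₅)
    (wu : ¬ G.Adj w u) : False := by
  refine hG.2 (.inr (.inl (isIndContained_of_adj_iff ![v₁, v₂, v₃, v₄, v₅, u, w] ?_ ?_)))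
  · intro i j
    fin_cases i <;> fin_cases j <;>
      simp [whippingTop, *, G.adj_comm]
  · simp only [whippingTop, SimpleGraph.fromEdgeSet_adj, Set.mem_insert_iff,
      Set.mem_singleton_iff]
    decide

/-! ### Uniform treatment of †- and ‡-witnesses -/

/-- A common description of the †-graph (`c₁ = c₂`) and the ‡-graph (`c₁ ≠ c₂`) with `d` base
vertices as induced subgraphs of `G`: the shallow terminal is `s`, the centers are `c₁, c₂`, and
the base path is `b 0, ..., b (d + 1)`. -/
structure IsAW (G : SimpleGraph V) (d : ℕ) (s c₁ c₂ : V) (b : ℕ → V) : Prop where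
  inj : ∀ i j, i ≤ d + 1 → j ≤ d + 1 → b i = b j → i = j
  path : ∀ i j, i ≤ d + 1 → j ≤ d + 1 → (G.Adj (b i) (b j) ↔ i + 1 = j ∨ j + 1 = i)
  s_base : ∀ i ≤ d + 1, ¬ G.Adj s (b i)
  s_c₁ : G.Adj s c₁
  s_c₂ : G.Adj s c₂
  c₁_base : ∀ i, 1 ≤ i → i ≤ d → G.Adj c₁ (b i)
  c₂_base : ∀ i, 1 ≤ i → i ≤ d → G.Adj c₂ (b i)
  -- When the centers coincide, these two fields together say that the single center misses both
  -- base terminals.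
  c₁_right : ¬ G.Adj c₁ (b (d + 1))
  c₂_left : ¬ G.Adj c₂ (b 0)
  centers : c₁ = c₂ ∨ (G.Adj c₁ c₂ ∧ G.Adj c₁ (b 0) ∧ G.Adj c₂ (b (d + 1)))

namespace IsAW

variable {d : ℕ} {s c₁ c₂ : V} {b : ℕ → V}

/-- The left-right symmetry that lets arguments at one end of the base serve the other. -/
theorem reverse (h : IsAW G d s c₁ c₂ b) : IsAW G d s c₂ c₁ (fun i => b (d + 1 - i)) where
  inj i j hi hj hij := by
    have := h.inj _ _ (by omega) (by omega) hij
    omega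
  path i j hi hj := by
    rw [h.path _ _ (by omega) (by omega)]
    omega
  s_base i hi := h.s_base _ (by omega)
  s_c₁ := h.s_c₂
  s_c₂ := h.s_c₁
  c₁_base i h1 h2 := h.c₂_base _ (by omega) (by omega)
  c₂_base i h1 h2 := h.c₁_base _ (by omega) (by omega)
  c₁_right := by simpa using h.c₂_left
  c₂_left := h.c₁_right
  centers := by
    rcases h.centers with h1 | ⟨h1, h2, h3⟩
    · exact .inl h1.symm
    · exact .inr ⟨h1.symm, h3, by simpa using h2⟩

theorem adj_succ (h : IsAW G d s c₁ c₂ b) {i : ℕ} (hi : i ≤ d) : G.Adj (b i) (b (i + 1)) :=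
  (h.path i (i + 1) (by omega) (by omega)).2 (.inl rfl)

theorem not_adj (h : IsAW G d s c₁ c₂ b) {i j : ℕ} (hi : i ≤ d + 1) (hj : j ≤ d + 1)
    (h1 : i + 1 ≠ j) (h2 : j + 1 ≠ i) : ¬ G.Adj (b i) (b j) := by
  rw [h.path i j hi hj]
  omega

theorem ne_base (h : IsAW G d s c₁ c₂ b) {i : ℕ} (hi : i ≤ d + 1) : s ≠ b i := by
  rintro rfl
  rcases Nat.eq_zero_or_pos i with rfl | hpos
  · exact h.s_base 1 (by omega) (h.adj_succ (i := 0) (by omega))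
  · refine h.s_base (i - 1) (by omega) ((h.path _ _ hi (by omega)).2 (by omega))

theorem ne_base_of_adj (h : IsAW G d s c₁ c₂ b) {x : V} (hx : G.Adj s x) {i : ℕ}
    (hi : i ≤ d + 1) : x ≠ b i := by
  rintro rfl
  exact h.s_base i hi hx

/-- The †-graph embedding given by an asteroidal witness with one center. -/
theorem exists_dag (h : IsAW G d s c₁ c₁ b) :
    ∃ f : dagGraph d ↪g G, f DagVertex.s = s := by
  let f : DagVertex d → V := fun v => match v with
    | .s => s
    | .c => c₁
    | .b i => b i.val
  have hs (i : Fin (d + 2)) : s ≠ b i.val := h.ne_base (by omega)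
  have hc (i : Fin (d + 2)) : c₁ ≠ b i.val := h.ne_base_of_adj h.s_c₁ (by omega)
  have hsb (i : Fin (d + 2)) : ¬ G.Adj s (b i.val) := h.s_base _ (by omega)
  have hcb (i : Fin (d + 2)) : G.Adj c₁ (b i.val) ↔ 1 ≤ i.val ∧ i.val ≤ d := by
    refine ⟨fun hi => ?_, fun hi => h.c₁_base _ hi.1 hi.2⟩
    by_contra hne
    have : i.val = 0 ∨ i.val = d + 1 := by omega
    rcases this with h0 | h0 <;> rw [h0] at hi
    · exact h.c₂_left hi
    · exact h.c₁_right hi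
  have hbb (i j : Fin (d + 2)) : G.Adj (b i.val) (b j.val) ↔ i.val + 1 = j ∨ j.val + 1 = i :=
    h.path _ _ (by omega) (by omega)
  have hf : Function.Injective f := by
    rintro (_ | _ | i) (_ | _ | j) hij <;> simp only [f] at hij
    · rfl
    · exact (h.s_c₁.ne hij).elim
    · exact (hs _ hij).elim
    · exact (h.s_c₁.ne hij.symm).elim
    · rfl
    · exact (hc _ hij).elim
    · exact (hs _ hij.symm).elim
    · exact (hc _ hij.symm).elim
    · rw [Fin.ext (h.inj _ _ (by omega) (by omega) hij)]
  refine ⟨⟨⟨f, hf⟩, ?_⟩, rfl⟩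
  intro x y
  change G.Adj (f x) (f y) ↔ _
  rcases x with _ | _ | i <;> rcases y with _ | _ | j <;>
    simp [f, dagGraph, DagVertex.rel, h.s_c₁, h.s_c₁.symm, hsb, hcb, hbb, G.adj_comm (b _) s,
      G.adj_comm (b _) c₁]
  rintro h1 rfl
  omega

/-- The ‡-graph embedding given by an asteroidal witness with two centers. -/
theorem exists_ddag (h : IsAW G d s c₁ c₂ b) (hne : c₁ ≠ c₂) :
    ∃ f : ddagGraph d ↪g G, f DDagVertex.s = s := by
  obtain ⟨hcc, hc₁, hc₂⟩ := h.centers.resolve_left hne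
  let f : DDagVertex d → V := fun v => match v with
    | .s => s
    | .c₁ => c₁
    | .c₂ => c₂
    | .b i => b i.val
  have hs (i : Fin (d + 2)) : s ≠ b i.val := h.ne_base (by omega)
  have hn₁ (i : Fin (d + 2)) : c₁ ≠ b i.val := h.ne_base_of_adj h.s_c₁ (by omega)
  have hn₂ (i : Fin (d + 2)) : c₂ ≠ b i.val := h.ne_base_of_adj h.s_c₂ (by omega)
  have hsb (i : Fin (d + 2)) : ¬ G.Adj s (b i.val) := h.s_base _ (by omega)
  have hb₁ (i : Fin (d + 2)) : G.Adj c₁ (b i.val) ↔ i.val ≤ d := by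
    refine ⟨fun hi => ?_, fun hi => ?_⟩
    · by_contra hne
      rw [show i.val = d + 1 by omega] at hi
      exact h.c₁_right hi
    · rcases Nat.eq_zero_or_pos i.val with h0 | h0
      · rwa [h0]
      · exact h.c₁_base _ h0 hi
  have hb₂ (i : Fin (d + 2)) : G.Adj c₂ (b i.val) ↔ 1 ≤ i.val := by
    refine ⟨fun hi => ?_, fun hi => ?_⟩
    · by_contra hne
      rw [show i.val = 0 by omega] at hi
      exact h.c₂_left hi
    · rcases Nat.lt_or_ge d i.val with h0 | h0
      · rwa [show i.val = d + 1 by omega]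
      · exact h.c₂_base _ hi h0
  have hbb (i j : Fin (d + 2)) : G.Adj (b i.val) (b j.val) ↔ i.val + 1 = j ∨ j.val + 1 = i :=
    h.path _ _ (by omega) (by omega)
  have hf : Function.Injective f := by
    rintro (_ | _ | _ | i) (_ | _ | _ | j) hij <;> simp only [f] at hij
    · rfl
    · exact (h.s_c₁.ne hij).elim
    · exact (h.s_c₂.ne hij).elim
    · exact (hs _ hij).elim
    · exact (h.s_c₁.ne hij.symm).elim
    · rfl
    · exact (hne hij).elim
    · exact (hn₁ _ hij).elim
    · exact (h.s_c₂.ne hij.symm).elim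
    · exact (hne hij.symm).elim
    · rfl
    · exact (hn₂ _ hij).elim
    · exact (hs _ hij.symm).elim
    · exact (hn₁ _ hij.symm).elim
    · exact (hn₂ _ hij.symm).elim
    · rw [Fin.ext (h.inj _ _ (by omega) (by omega) hij)]
  refine ⟨⟨⟨f, hf⟩, ?_⟩, rfl⟩
  intro x y
  change G.Adj (f x) (f y) ↔ _
  rcases x with _ | _ | _ | i <;> rcases y with _ | _ | _ | j <;>
    simp [f, ddagGraph, DDagVertex.rel, h.s_c₁, h.s_c₁.symm, h.s_c₂, h.s_c₂.symm, hcc, hcc.symm,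
      hsb, hb₁, hb₂, hbb, G.adj_comm (b _) s, G.adj_comm (b _) c₁, G.adj_comm (b _) c₂]
  rintro h1 rfl
  omega

theorem mem_shallowTerminals (h : IsAW G d s c₁ c₂ b) (hd : 3 < d) : s ∈ shallowTerminals G := by
  by_cases hc : c₁ = c₂
  · subst hc
    exact ⟨d, hd, .inl h.exists_dag⟩
  · exact ⟨d, hd, .inr (h.exists_ddag hc)⟩

/-- An asteroidal witness of a reduced graph is long. -/
theorem three_lt (h : IsAW G d s c₁ c₂ b) (hG : IsReduced G) (hd : 1 ≤ d)
    (hd' : c₁ = c₂ → 2 ≤ d) : 3 < d := by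
  by_contra hle
  by_cases hc : c₁ = c₂
  · have := hd' hc
    subst hc
    obtain ⟨f, -⟩ := h.exists_dag
    exact hG.2 (.inr (.inr (.inl ⟨d, this, by omega, ⟨f⟩⟩)))
  · obtain ⟨f, -⟩ := h.exists_ddag hc
    exact hG.2 (.inr (.inr (.inr ⟨d, hd, by omega, ⟨f⟩⟩)))

end IsAW

theorem exists_isAW_of_mem_shallowTerminals {v : V} (hv : v ∈ shallowTerminals G) :
    ∃ d c₁ c₂ b, 3 < d ∧ IsAW G d v c₁ c₂ b := by
  obtain ⟨d, hd, ⟨f, rfl⟩ | ⟨f, rfl⟩⟩ := hv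
  · let b : ℕ → V := fun i => if hi : i < d + 2 then f (.b ⟨i, hi⟩) else f .s
    have hb (i : ℕ) (hi : i ≤ d + 1) : b i = f (.b ⟨i, by omega⟩) := dif_pos (by omega)
    refine ⟨d, f .c, f .c, b, hd, ⟨?_, ?_, ?_, ?_, ?_, ?_, ?_, ?_, ?_, .inl rfl⟩⟩
    · intro i j hi hj hij
      rw [hb i hi, hb j hj] at hij
      simpa using f.injective hij
    · intro i j hi hj
      rw [hb i hi, hb j hj, f.map_adj_iff]
      simp [dagGraph, DagVertex.rel]
      omega
    · intro i hi
      rw [hb i hi, f.map_adj_iff]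
      simp [dagGraph, DagVertex.rel]
    · rw [f.map_adj_iff]
      simp [dagGraph, DagVertex.rel]
    · rw [f.map_adj_iff]
      simp [dagGraph, DagVertex.rel]
    · intro i h1 h2
      rw [hb i (by omega), f.map_adj_iff]
      simp [dagGraph, DagVertex.rel, h1, h2]
    · intro i h1 h2
      rw [hb i (by omega), f.map_adj_iff]
      simp [dagGraph, DagVertex.rel, h1, h2]
    · rw [hb _ le_rfl, f.map_adj_iff]
      simp [dagGraph, DagVertex.rel]
    · rw [hb 0 (by omega), f.map_adj_iff]
      simp [dagGraph, DagVertex.rel]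
  · let b : ℕ → V := fun i => if hi : i < d + 2 then f (.b ⟨i, hi⟩) else f .s
    have hb (i : ℕ) (hi : i ≤ d + 1) : b i = f (.b ⟨i, by omega⟩) := dif_pos (by omega)
    refine ⟨d, f .c₁, f .c₂, b, hd, ⟨?_, ?_, ?_, ?_, ?_, ?_, ?_, ?_, ?_, .inr ⟨?_, ?_, ?_⟩⟩⟩
    · intro i j hi hj hij
      rw [hb i hi, hb j hj] at hij
      simpa using f.injective hij
    · intro i j hi hj
      rw [hb i hi, hb j hj, f.map_adj_iff]
      simp [ddagGraph, DDagVertex.rel]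
      omega
    · intro i hi
      rw [hb i hi, f.map_adj_iff]
      simp [ddagGraph, DDagVertex.rel]
    · rw [f.map_adj_iff]
      simp [ddagGraph, DDagVertex.rel]
    · rw [f.map_adj_iff]
      simp [ddagGraph, DDagVertex.rel]
    · intro i h1 h2
      rw [hb i (by omega), f.map_adj_iff]
      simp [ddagGraph, DDagVertex.rel, h2]
    · intro i h1 h2
      rw [hb i (by omega), f.map_adj_iff]
      simp [ddagGraph, DDagVertex.rel, h1]
    · rw [hb _ le_rfl, f.map_adj_iff]
      simp [ddagGraph, DDagVertex.rel]
    · rw [hb 0 (by omega), f.map_adj_iff]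
      simp [ddagGraph, DDagVertex.rel]
    · rw [f.map_adj_iff]
      simp [ddagGraph, DDagVertex.rel]
    · rw [hb 0 (by omega), f.map_adj_iff]
      simp [ddagGraph, DDagVertex.rel]
    · rw [hb _ le_rfl, f.map_adj_iff]
      simp [ddagGraph, DDagVertex.rel]

/-- The †-graph with two base vertices is the net: a triangle `c p q` with pendant vertices
`s, p', q'`. -/
theorem IsReduced.no_net (hG : IsReduced G) {s c p' p q q' : V}
    (sc : G.Adj s c) (cp : G.Adj c p) (cq : G.Adj c q) (pq : G.Adj p q)
    (pp : G.Adj p' p) (qq : G.Adj q q')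
    (n1 : ¬ G.Adj s p') (n2 : ¬ G.Adj s p) (n3 : ¬ G.Adj s q) (n4 : ¬ G.Adj s q')
    (n5 : ¬ G.Adj c p') (n6 : ¬ G.Adj c q') (n7 : ¬ G.Adj p' q) (n8 : ¬ G.Adj p' q')
    (n9 : ¬ G.Adj p q') : False := by
  have e1 : p' ≠ q := by rintro rfl; exact n5 cq
  have e2 : p' ≠ q' := by rintro rfl; exact n7 qq.symm
  have e3 : p ≠ q' := by rintro rfl; exact n6 cp
  have e4 := pp.ne
  have e5 := qq.ne
  have e6 := pq.ne
  have h : IsAW G 2 s c c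
      (fun i => if i = 0 then p' else if i = 1 then p else if i = 2 then q else q') := by
    refine ⟨?_, ?_, ?_, sc, sc, ?_, ?_, n6, n5, .inl rfl⟩
    · intro i j hi hj
      interval_cases i <;> interval_cases j <;> simp [*, eq_comm]
    · intro i j hi hj
      interval_cases i <;> interval_cases j <;> simp [*, G.adj_comm]
    · intro i hi
      interval_cases i <;> simp [*]
    · intro i h1 h2
      interval_cases i <;> simp [*]
    · intro i h1 h2
      interval_cases i <;> simp [*]
  have := h.three_lt hG (by omega) (by omega)
  omega

/-- The ‡-graph with one base vertex is the sun: a triangle `c₁ c₂ m` and vertices `s, x, z`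
adjacent to two of its vertices each. -/
theorem IsReduced.no_sun (hG : IsReduced G) {s c₁ c₂ x m z : V}
    (s1 : G.Adj s c₁) (s2 : G.Adj s c₂) (cc : G.Adj c₁ c₂) (m1 : G.Adj c₁ m) (m2 : G.Adj c₂ m)
    (x1 : G.Adj c₁ x) (xm : G.Adj x m) (z2 : G.Adj c₂ z) (mz : G.Adj m z)
    (n1 : ¬ G.Adj s x) (n2 : ¬ G.Adj s m) (n3 : ¬ G.Adj s z) (n4 : ¬ G.Adj c₁ z)
    (n5 : ¬ G.Adj c₂ x) (n6 : ¬ G.Adj x z) : False := by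
  have e1 : x ≠ z := by rintro rfl; exact n4 x1
  have e2 := xm.ne
  have e3 := mz.ne
  have h : IsAW G 1 s c₁ c₂ (fun i => if i = 0 then x else if i = 1 then m else z) := by
    refine ⟨?_, ?_, ?_, s1, s2, ?_, ?_, n4, n5, .inr ⟨cc, x1, z2⟩⟩
    · intro i j hi hj
      interval_cases i <;> interval_cases j <;> simp [*, eq_comm]
    · intro i j hi hj
      interval_cases i <;> interval_cases j <;> simp [*, G.adj_comm]
    · intro i hi
      interval_cases i <;> simp [*]
    · intro i h1 h2
      interval_cases i
      simp [*]
    · intro i h1 h2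
      interval_cases i
      simp [*]
  have := h.three_lt hG le_rfl fun h => (cc.ne h).elim
  omega

/-! ### Neighbors of the shallow terminal -/

namespace IsAW

variable {d : ℕ} {s c₁ c₂ : V} {b : ℕ → V}

/-- If `x` missed `c₁`, holes would exclude edges from `x` to the base terminals. Then a † gives a
long claw centered at `c₁` with legs through `s`, `b 1`, `b d`. A ‡ gives a whipping top on the path
x, s, c₁, b d, b (d + 1) if `x` sees `c₂`, and otherwise a net on the triangle s, c₁, c₂. -/
theorem adj_c₁_of_base_free (h : IsAW G d s c₁ c₂ b) (hG : IsReduced G) (hd : 3 < d) {x : V}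
    (hx : G.Adj s x) (hfree : ∀ i, 1 ≤ i → i ≤ d → ¬ G.Adj x (b i)) : G.Adj x c₁ := by
  by_contra hx1
  have hxne1 : x ≠ c₁ := by
    rintro rfl
    exact hfree 1 le_rfl (by omega) (h.c₁_base 1 le_rfl (by omega))
  have hxne2 : x ≠ c₂ := by
    rintro rfl
    exact hfree 1 le_rfl (by omega) (h.c₂_base 1 le_rfl (by omega))
  have x1 := hfree 1 le_rfl (by omega)
  have xd := hfree d (by omega) le_rfl
  have s0 := h.s_base 0 (by omega)
  have s1 := h.s_base 1 (by omega)
  have sd := h.s_base d (by omega)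
  have sr := h.s_base (d + 1) (by omega)
  have hxr : ¬ G.Adj x (b (d + 1)) := fun hxr =>
    hG.no_five_cycle hx.symm h.s_c₁ (h.c₁_base d (by omega) le_rfl) (h.adj_succ le_rfl)
      hxr.symm hx1 xd sd sr h.c₁_right
  have b01 := h.adj_succ (i := 0) (by omega)
  have bdr := h.adj_succ (i := d) le_rfl
  have n0d := h.not_adj (i := 0) (j := d) (by omega) (by omega) (by omega) (by omega)
  have n0r := h.not_adj (i := 0) (j := d + 1) (by omega) (by omega) (by omega) (by omega)
  have n1d := h.not_adj (i := 1) (j := d) (by omega) (by omega) (by omega) (by omega)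
  have n1r := h.not_adj (i := 1) (j := d + 1) (by omega) (by omega) (by omega) (by omega)
  have c1d := h.c₁_base d (by omega) le_rfl
  rcases h.centers with rfl | ⟨hcc, hl, hr⟩
  · have c11 := h.c₁_base 1 le_rfl (by omega)
    have hx0 : ¬ G.Adj x (b 0) := fun hx0 =>
      hG.no_five_cycle hx.symm h.s_c₁ c11 b01.symm hx0.symm hx1 x1 s1 s0 h.c₂_left
    exact hG.no_longClaw h.s_c₁.symm c11 c1d hx b01.symm bdr (fun t => hx1 t.symm) h.c₂_left
      h.c₁_right s1 sd n1d s0 sr (fun t => x1 t.symm) n1r (fun t => xd t.symm)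
      (fun t => n0d t.symm) hx0 hxr n0r
  · have hx0 : ¬ G.Adj x (b 0) := fun hx0 =>
      s0 (hG.adj_of_four_cycle hx.symm h.s_c₁ hl hx0.symm hxne1 (h.ne_base (by omega)) hx1)
    by_cases hx2 : G.Adj x c₂
    · exact hG.no_whippingTop hx.symm h.s_c₁ c1d bdr hx2.symm h.s_c₂.symm hcc.symm
        (h.c₂_base d (by omega) le_rfl) hr hl.symm hx1 xd hxr sd sr h.c₁_right
        (fun t => hx0 t.symm) (fun t => s0 t.symm) n0d n0r (fun t => h.c₂_left t.symm)
    · exact hG.no_net hx.symm h.s_c₁ h.s_c₂ hcc hl.symm hr hx0 hx1 hx2 hxr s0 sr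
        (fun t => h.c₂_left t.symm) n0r h.c₁_right

/-- A neighbor of the shallow terminal without neighbors in the base can replace the shallow
terminal. -/
theorem replace_terminal (h : IsAW G d s c₁ c₂ b) (hG : IsReduced G) (hd : 3 < d) {x : V}
    (hx : G.Adj s x) (hfree : ∀ i, 1 ≤ i → i ≤ d → ¬ G.Adj x (b i)) : IsAW G d x c₁ c₂ b := by
  have hx1 := h.adj_c₁_of_base_free hG hd hx hfree
  have hx2 := h.reverse.adj_c₁_of_base_free hG hd hx
    fun i h1 h2 => hfree (d + 1 - i) (by omega) (by omega)
  refine { h with s_base := fun i hi hxi => ?_, s_c₁ := hx1, s_c₂ := hx2 }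
  by_cases hi' : 1 ≤ i ∧ i ≤ d
  · exact hfree i hi'.1 hi'.2 hxi
  have : i = 0 ∨ i = d + 1 := by omega
  -- A base terminal adjacent to `x` would close a 4-cycle with its base neighbor and the center
  -- that misses it, forcing `x` to see the base.
  rcases this with rfl | rfl
  · refine hfree 1 le_rfl (by omega) (hG.adj_of_four_cycle (h.adj_succ (i := 0) (by omega))
      (h.c₂_base 1 le_rfl (by omega)).symm hx2.symm hxi
      (h.ne_base_of_adj h.s_c₂ (by omega)).symm (h.ne_base_of_adj hx (by omega)).symm
      fun t => h.c₂_left t.symm).symm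
  · refine hfree d (by omega) le_rfl (hG.adj_of_four_cycle (h.adj_succ (i := d) le_rfl).symm
      (h.c₁_base d (by omega) le_rfl).symm hx1.symm hxi
      (h.ne_base_of_adj h.s_c₁ le_rfl).symm (h.ne_base_of_adj hx (by omega)).symm
      fun t => h.c₁_right t.symm).symm

/-- Otherwise the 4-cycle y, s, c₁, b k would force a chord from `s` to the base. -/
theorem eq_or_adj_c₁ (h : IsAW G d s c₁ c₂ b) (hG : IsReduced G) {y : V} (hy : G.Adj s y)
    {k : ℕ} (hk : 1 ≤ k) (hkd : k ≤ d) (hyk : G.Adj y (b k)) : y = c₁ ∨ G.Adj y c₁ := by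
  by_contra! hne
  exact h.s_base k (by omega) (hG.adj_of_four_cycle hy.symm h.s_c₁ (h.c₁_base k hk hkd) hyk.symm
    hne.1 (h.ne_base (by omega)) hne.2)

/-- A common neighbor of the shallow terminal and of the whole base is adjacent to every
alternative choice of the shallow terminal that is adjacent to the original one. -/
theorem adj_of_base_full (h : IsAW G d s c₁ c₂ b) (hG : IsReduced G) (hd : 3 < d) {x y : V}
    (hx : IsAW G d x c₁ c₂ b) (hsx : G.Adj s x) (hsy : G.Adj s y)
    (hfull : ∀ i, 1 ≤ i → i ≤ d → G.Adj y (b i)) : G.Adj x y := by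
  have y1 := hfull 1 le_rfl (by omega)
  have yd := hfull d (by omega) le_rfl
  rcases h.eq_or_adj_c₁ hG hsy le_rfl (by omega) y1 with rfl | hy1
  · exact hx.s_c₁
  rcases h.reverse.eq_or_adj_c₁ hG hsy (k := d) (by omega) le_rfl (by simpa using y1)
    with rfl | hy2
  · exact hx.s_c₂
  by_contra hxy
  have hfree (i : ℕ) (_ : 1 ≤ i) (hi : i ≤ d) : ¬ G.Adj x (b i) := hx.s_base i (by omega)
  have x0 := hx.s_base 0 (by omega)
  have x1 := hx.s_base 1 (by omega)
  have xd := hx.s_base d (by omega)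
  have xr := hx.s_base (d + 1) (by omega)
  have b01 := h.adj_succ (i := 0) (by omega)
  have bdr := h.adj_succ (i := d) le_rfl
  have n0d := h.not_adj (i := 0) (j := d) (by omega) (by omega) (by omega) (by omega)
  have n0r := h.not_adj (i := 0) (j := d + 1) (by omega) (by omega) (by omega) (by omega)
  have n1d := h.not_adj (i := 1) (j := d) (by omega) (by omega) (by omega) (by omega)
  have n1r := h.not_adj (i := 1) (j := d + 1) (by omega) (by omega) (by omega) (by omega)
  -- Either `x` and `y` lie in a whipping top, sun or net, or `y` can itself serve as a center,
  -- which the base-free `x` must then see.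
  by_cases hy0 : G.Adj y (b 0) <;> by_cases hyr : G.Adj y (b (d + 1))
  · rcases h.centers with rfl | ⟨hcc, hl, hr⟩
    · exact hG.no_whippingTop b01 (h.c₁_base 1 le_rfl (by omega)).symm
        (h.c₁_base d (by omega) le_rfl) bdr hy0 y1 hy1 yd hyr hx.s_c₁
        (fun t => h.c₂_left t.symm) n0d n0r n1d n1r h.c₁_right x0 x1 xd xr hxy
    · exact hG.no_sun hx.s_c₁ hx.s_c₂ hcc hy1.symm hy2.symm hl hy0.symm hr hyr x0 hxy xr
        h.c₁_right h.c₂_left n0r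
  · rcases h.centers with rfl | ⟨hcc, hl, hr⟩
    · exact hG.no_net hx.s_c₁ hy1.symm (h.c₁_base d (by omega) le_rfl) yd hy0.symm bdr x0 hxy xd
        xr h.c₂_left h.c₁_right n0d n0r hyr
    · have h' : IsAW G d s y c₂ b :=
        { h with s_c₁ := hsy, c₁_base := hfull, c₁_right := hyr, centers := .inr ⟨hy2, hy0, hr⟩ }
      exact hxy (h'.adj_c₁_of_base_free hG hd hsx hfree)
  · rcases h.centers with rfl | ⟨hcc, hl, hr⟩
    · exact hG.no_net hx.s_c₁ hy1.symm (h.c₁_base 1 le_rfl (by omega)) y1 hyr.symm b01.symm xr hxy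
        x1 x0 h.c₁_right h.c₂_left (fun t => n1r t.symm) (fun t => n0r t.symm) hy0
    · have h' : IsAW G d s c₁ y b :=
        { h with
          s_c₂ := hsy, c₂_base := hfull, c₂_left := hy0, centers := .inr ⟨hy1.symm, hl, hyr⟩ }
      exact hxy (h'.replace_terminal hG hd hsx hfree).s_c₂
  · have h' : IsAW G d s y y b :=
      { h with
        s_c₁ := hsy, s_c₂ := hsy, c₁_base := hfull, c₂_base := hfull, c₁_right := hyr,
        c₂_left := hy0, centers := .inl rfl }
    exact hxy (h'.adj_c₁_of_base_free hG hd hsx hfree)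

/-- The neighbors of `y` on the path form an interval from `p` to `q`, with `q < d`. If `p = 0`,
then `y` and `c₂` are the centers of a shorter ‡; if `0 < p < q`, then `y` is the center of a
shorter †. A single neighbor `p = q` is impossible. Reducedness makes the new witness long again. -/
theorem exists_shorter_of_left (h : IsAW G d s c₁ c₂ b) (hG : IsReduced G) (hd : 3 < d) {y : V}
    (hy : G.Adj s y) {k m : ℕ} (hk : 1 ≤ k) (hkm : k < m) (hm : m ≤ d)
    (hyk : G.Adj y (b k)) (hym : ¬ G.Adj y (b m)) :
    ∃ d' c₁' c₂' b', 3 < d' ∧ d' < d ∧ IsAW G d' s c₁' c₂' b' ∧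
      ∀ i, 1 ≤ i → i ≤ d' → ∃ j, 1 ≤ j ∧ j ≤ d ∧ b' i = b j := by
  classical
  have hyb (i : ℕ) (hi : i ≤ d + 1) : y ≠ b i := h.ne_base_of_adj hy hi
  have between {i m j : ℕ} (him : i ≤ m) (hmj : m ≤ j) (hj : j ≤ d + 1)
      (hyi : G.Adj y (b i)) (hyj : G.Adj y (b j)) : G.Adj y (b m) :=
    hG.adj_between h.inj h.path hyb him hmj hj hyi hyj
  obtain ⟨q, hkq, hqm, hyq, hyq'⟩ : ∃ q, k ≤ q ∧ q < m ∧ G.Adj y (b q) ∧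
      ¬ G.Adj y (b (q + 1)) := by
    by_contra! hcon
    have (n : ℕ) (hn : k ≤ n) : n ≤ m → G.Adj y (b n) := by
      induction n, hn using Nat.le_induction with
      | base => exact fun _ => hyk
      | succ n hn ih => exact fun hle => hcon n hn (by omega) (ih (by omega))
    exact hym (this m hkm.le le_rfl)
  have hex : ∃ p, G.Adj y (b p) := ⟨q, hyq⟩
  have hyp := Nat.find_spec hex
  have hpq : Nat.find hex ≤ q := Nat.find_min' hex hyq
  have hpmin (i : ℕ) (hi : i < Nat.find hex) : ¬ G.Adj y (b i) := Nat.find_min hex hi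
  generalize Nat.find hex = p at hyp hpq hpmin
  have hyadj (i : ℕ) (h1 : p ≤ i) (h2 : i ≤ q) : G.Adj y (b i) :=
    between h1 h2 (by omega) hyp hyq
  have hy2 : G.Adj y c₂ := by
    rcases h.reverse.eq_or_adj_c₁ hG hy (k := d + 1 - k) (by omega) (by omega)
      (by rwa [show d + 1 - (d + 1 - k) = k by omega]) with rfl | hy2
    · exact (hym (h.c₂_base m (by omega) hm)).elim
    · exact hy2
  have hqn : q + 1 ≤ d := by omega
  rcases Nat.eq_zero_or_pos p with rfl | hp
  · have h' : IsAW G q s y c₂ b :=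
      { inj := fun i j hi hj => h.inj i j (by omega) (by omega)
        path := fun i j hi hj => h.path i j (by omega) (by omega)
        s_base := fun i hi => h.s_base i (by omega)
        s_c₁ := hy
        s_c₂ := h.s_c₂
        c₁_base := fun i _ hi => hyadj i (by omega) hi
        c₂_base := fun i h1 h2 => h.c₂_base i h1 (by omega)
        c₁_right := hyq'
        c₂_left := h.c₂_left
        centers := .inr ⟨hy2, hyp, h.c₂_base (q + 1) (by omega) hqn⟩ }
    exact ⟨q, y, c₂, b, h'.three_lt hG (by omega) fun e => (hy2.ne e).elim, by omega, h',
      fun i h1 h2 => ⟨i, h1, by omega, rfl⟩⟩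
  rcases Nat.lt_or_ge p q with hlt | hge
  · have h' : IsAW G (q - p + 1) s y y (fun i => b (p - 1 + i)) :=
      { inj := fun i j hi hj hij => by
          have := h.inj _ _ (by omega) (by omega) hij
          omega
        path := fun i j hi hj => by
          rw [h.path _ _ (by omega) (by omega)]
          omega
        s_base := fun i hi => h.s_base _ (by omega)
        s_c₁ := hy
        s_c₂ := hy
        c₁_base := fun i _ hi => hyadj _ (by omega) (by omega)
        c₂_base := fun i _ hi => hyadj _ (by omega) (by omega)
        c₁_right := by
          rwa [show p - 1 + (q - p + 1 + 1) = q + 1 by omega]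
        c₂_left := hpmin _ (by omega)
        centers := .inl rfl }
    exact ⟨_, _, _, _, h'.three_lt hG (by omega) fun _ => by omega, by omega, h',
      fun i h1 h2 => ⟨p - 1 + i, by omega, by omega, rfl⟩⟩
  · exfalso
    obtain rfl : p = q := by omega
    have hnext (i : ℕ) (h1 : p < i) (h2 : i ≤ d + 1) : ¬ G.Adj y (b i) :=
      fun hi => hyq' (between (by omega) h1 h2 hyp hi)
    have s1 := h.s_base p (by omega)
    have s2 := h.s_base (p + 1) (by omega)
    have s3 := h.s_base (p + 2) (by omega)
    have e1 := h.adj_succ (i := p) (by omega)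
    have e2 := h.adj_succ (i := p + 1) (by omega)
    have n1 := h.not_adj (i := p) (j := p + 2) (by omega) (by omega) (by omega) (by omega)
    have hy1 := hnext (p + 1) (by omega) (by omega)
    have hy3 := hnext (p + 2) (by omega) (by omega)
    obtain ⟨r, rfl⟩ : ∃ r, p = r + 1 := ⟨p - 1, by omega⟩
    have e0 := h.adj_succ (i := r) (by omega)
    have hyr := hpmin r (by omega)
    have sr := h.s_base r (by omega)
    have m1 := h.not_adj (i := r) (j := r + 1 + 1) (by omega) (by omega) (by omega) (by omega)
    have m2 := h.not_adj (i := r) (j := r + 1 + 2) (by omega) (by omega) (by omega) (by omega)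
    -- For `p = 1` the whipping top has path s, y, b 1, b 2, b 3, dominating vertex `c₂` and pendant
    -- `b 0`; for larger `p` there is a long claw centered at `b p`.
    rcases Nat.eq_zero_or_pos r with rfl | hr
    · exact hG.no_whippingTop hy hyp e1 e2 h.s_c₂.symm hy2.symm (h.c₂_base _ (by omega) (by omega))
        (h.c₂_base _ (by omega) (by omega)) (h.c₂_base _ (by omega) (by omega)) e0 s1 s2 s3 hy1 hy3
        n1 (fun t => sr t.symm) (fun t => hyr t.symm) m1 m2 (fun t => h.c₂_left t.symm)
    · obtain ⟨t, rfl⟩ : ∃ t, r = t + 1 := ⟨r - 1, by omega⟩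
      have f0 := h.adj_succ (i := t) (by omega)
      have ft := h.not_adj (i := t + 1 + 1) (j := t) (by omega) (by omega) (by omega) (by omega)
      have ft1 := h.not_adj (i := t + 1 + 1 + 1) (j := t) (by omega) (by omega) (by omega)
        (by omega)
      have ft2 := h.not_adj (i := t) (j := t + 1 + 1 + 2) (by omega) (by omega) (by omega)
        (by omega)
      exact hG.no_longClaw hyp.symm e0.symm e1 hy.symm f0.symm e2 (fun u => s1 u.symm) ft n1
        hyr hy1 m1 (hpmin t (by omega)) hy3 (fun u => sr u.symm) m2 (fun u => s2 u.symm) ft1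
        (h.s_base t (by omega)) s3 ft2

/-- A neighbor of the shallow terminal that sees a part of the base only yields an asteroidal
witness with the same shallow terminal and a shorter base. -/
theorem exists_shorter (h : IsAW G d s c₁ c₂ b) (hG : IsReduced G) (hd : 3 < d) {y : V}
    (hy : G.Adj s y) {k m : ℕ} (hk : 1 ≤ k) (hkd : k ≤ d) (hm : 1 ≤ m) (hmd : m ≤ d)
    (hyk : G.Adj y (b k)) (hym : ¬ G.Adj y (b m)) :
    ∃ d' c₁' c₂' b', 3 < d' ∧ d' < d ∧ IsAW G d' s c₁' c₂' b' ∧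
      ∀ i, 1 ≤ i → i ≤ d' → ∃ j, 1 ≤ j ∧ j ≤ d ∧ b' i = b j := by
  rcases lt_trichotomy k m with hkm | rfl | hkm
  · exact h.exists_shorter_of_left hG hd hy hk hkm hmd hyk hym
  · exact (hym hyk).elim
  · obtain ⟨d', c₁', c₂', b', h1, h2, h3, h4⟩ := h.reverse.exists_shorter_of_left hG hd hy
      (k := d + 1 - k) (m := d + 1 - m) (by omega) (by omega) (by omega)
      (by rwa [show d + 1 - (d + 1 - k) = k by omega])
      (by rwa [show d + 1 - (d + 1 - m) = m by omega])
    refine ⟨d', c₁', c₂', b', h1, h2, h3, fun i hi hi' => ?_⟩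
    obtain ⟨j, hj, hj', e⟩ := h4 i hi hi'
    exact ⟨d + 1 - j, by omega, by omega, e⟩

end IsAW

/-! ### The module around one shallow terminal -/

/-- The vertices that can be reached from `s` along vertices without neighbors in the base
`b 1, ..., b d`. -/
def terminalSet (G : SimpleGraph V) (d : ℕ) (b : ℕ → V) (s : V) : Set V :=
  {u | Relation.ReflTransGen
    (fun v w => G.Adj v w ∧ ∀ i, 1 ≤ i → i ≤ d → ¬ G.Adj w (b i)) s u}

namespace IsAW

variable {d : ℕ} {s c₁ c₂ : V} {b : ℕ → V}

theorem of_mem_terminalSet (h : IsAW G d s c₁ c₂ b) (hG : IsReduced G) (hd : 3 < d) {u : V}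
    (hu : u ∈ terminalSet G d b s) : IsAW G d u c₁ c₂ b := by
  induction hu with
  | refl => exact h
  | tail _ hvw ih => exact ih.replace_terminal hG hd hvw.1 hvw.2

/-- An asteroidal witness at a vertex of the terminal set, with base inside the given base, can be
transferred to the original shallow terminal. -/
theorem transfer (h : IsAW G d s c₁ c₂ b) (hG : IsReduced G) (hd : 3 < d) {u : V}
    (hu : u ∈ terminalSet G d b s) {d' : ℕ} {c₁' c₂' : V} {b' : ℕ → V} (hd' : 3 < d')
    (hsub : ∀ i, 1 ≤ i → i ≤ d' → ∃ j, 1 ≤ j ∧ j ≤ d ∧ b' i = b j)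
    (h' : IsAW G d' u c₁' c₂' b') : IsAW G d' s c₁' c₂' b' := by
  induction hu with
  | refl => exact h'
  | tail hv hvw ih =>
    -- Going back one step towards `s`: the predecessor is a terminal over the old base, so it also
    -- misses the new base inside it.
    refine ih (h'.replace_terminal hG hd' hvw.1.symm fun i h1 h2 => ?_)
    obtain ⟨j, -, hj, e⟩ := hsub i h1 h2
    rw [e]
    exact (h.of_mem_terminalSet hG hd hv).s_base j (by omega)

theorem reachable_of_mem_terminalSet (h : IsAW G d s c₁ c₂ b) (hG : IsReduced G) (hd : 3 < d)
    {u : V} (hu : u ∈ terminalSet G d b s) (hs : s ∈ shallowTerminals G) :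
    ∃ hu' : u ∈ shallowTerminals G,
      (G.induce (shallowTerminals G)).Reachable ⟨s, hs⟩ ⟨u, hu'⟩ := by
  induction hu with
  | refl => exact ⟨hs, .refl _⟩
  | tail hv hvw ih =>
    obtain ⟨hv', hr⟩ := ih
    have hw' := ((h.of_mem_terminalSet hG hd hv).replace_terminal hG hd hvw.1
      hvw.2).mem_shallowTerminals hd
    exact ⟨hw', hr.trans (SimpleGraph.Adj.reachable (SimpleGraph.induce_adj.2 hvw.1))⟩

/-- A vertex that is adjacent to the whole base sees either all or nothing of the terminal set. -/
theorem adj_iff_of_base_full (h : IsAW G d s c₁ c₂ b) (hG : IsReduced G) (hd : 3 < d) {u y : V}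
    (hu : u ∈ terminalSet G d b s) (hfull : ∀ i, 1 ≤ i → i ≤ d → G.Adj y (b i)) :
    G.Adj s y ↔ G.Adj u y := by
  induction hu with
  | refl => rfl
  | tail hv hvw ih =>
    have h1 := h.of_mem_terminalSet hG hd hv
    have h2 := h1.replace_terminal hG hd hvw.1 hvw.2
    rw [ih]
    exact ⟨fun t => h1.adj_of_base_full hG hd h2 hvw.1 t hfull,
      fun t => h2.adj_of_base_full hG hd h1 hvw.1.symm t hfull⟩

/-- If the base is as short as possible, then every neighbor of the terminal set is adjacent to
the whole base. -/
theorem base_full_of_minimal (h : IsAW G d s c₁ c₂ b) (hG : IsReduced G) (hd : 3 < d)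
    (hmin : ∀ d' c₁' c₂' b', 3 < d' → IsAW G d' s c₁' c₂' b' → d ≤ d') {u x : V}
    (hu : u ∈ terminalSet G d b s) (hx : x ∉ terminalSet G d b s) (hux : G.Adj u x) :
    ∀ i, 1 ≤ i → i ≤ d → G.Adj x (b i) := by
  by_contra! hcon
  obtain ⟨m, hm, hmd, hxm⟩ := hcon
  obtain ⟨k, hk, hkd, hxk⟩ : ∃ k, 1 ≤ k ∧ k ≤ d ∧ G.Adj x (b k) := by
    by_contra! hfree
    exact hx (Relation.ReflTransGen.tail hu ⟨hux, hfree⟩)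
  obtain ⟨d', c₁', c₂', b', h1, h2, h3, h4⟩ :=
    (h.of_mem_terminalSet hG hd hu).exists_shorter hG hd hux hk hkd hm hmd hxk hxm
  exact absurd (hmin _ _ _ _ h1 (h.transfer hG hd hu h1 h4 h3)) (by omega)

end IsAW

/-- Every shallow terminal `s` lies in a module `A` of shallow terminals, reachable from `s`, whose
neighborhood is a clique; moreover, the neighborhood has a common neighbor that is not adjacent
to `s`. -/
theorem exists_module_of_mem_shallowTerminals (hG : IsReduced G) {s : V}
    (hs : s ∈ shallowTerminals G) :
    ∃ A : Set V, s ∈ A ∧ IsModule G A ∧ G.IsClique (nbhd G A) ∧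
      (∀ u ∈ A, ∃ hu : u ∈ shallowTerminals G,
        (G.induce (shallowTerminals G)).Reachable ⟨s, hs⟩ ⟨u, hu⟩) ∧
      ∃ z, s ≠ z ∧ ¬ G.Adj s z ∧ ∀ t ∈ nbhd G A, G.Adj t z := by
  classical
  have hex : ∃ d, 3 < d ∧ ∃ c₁ c₂ b, IsAW G d s c₁ c₂ b := by
    obtain ⟨d, c₁, c₂, b, hd, h⟩ := exists_isAW_of_mem_shallowTerminals hs
    exact ⟨d, hd, c₁, c₂, b, h⟩
  obtain ⟨hd, c₁, c₂, b, h⟩ := Nat.find_spec hex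
  have hmin : ∀ d' c₁' c₂' b', 3 < d' → IsAW G d' s c₁' c₂' b' → Nat.find hex ≤ d' :=
    fun d' c₁' c₂' b' h1 h2 => Nat.find_min' hex ⟨h1, c₁', c₂', b', h2⟩
  generalize Nat.find hex = d at hd h hmin
  have full {u x : V} (hu : u ∈ terminalSet G d b s) (hx : x ∉ terminalSet G d b s)
      (hux : G.Adj u x) : ∀ i, 1 ≤ i → i ≤ d → G.Adj x (b i) :=
    h.base_full_of_minimal hG hd hmin hu hx hux
  have adj_s {u x : V} (hu : u ∈ terminalSet G d b s) (hx : x ∉ terminalSet G d b s)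
      (hux : G.Adj u x) : G.Adj s x :=
    (h.adj_iff_of_base_full hG hd hu (full hu hx hux)).2 hux
  refine ⟨terminalSet G d b s, Relation.ReflTransGen.refl, ?_, ?_,
    fun u hu => h.reachable_of_mem_terminalSet hG hd hu hs,
    b 1, h.ne_base (by omega), h.s_base 1 (by omega), ?_⟩
  · have key (u) (hu : u ∈ terminalSet G d b s) (v) (hv : v ∈ terminalSet G d b s) (x)
        (hx : x ∉ terminalSet G d b s) (hux : G.Adj u x) : G.Adj v x :=
      (h.adj_iff_of_base_full hG hd hv (full hu hx hux)).1 (adj_s hu hx hux)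
    exact fun u hu v hv x hx => ⟨key u hu v hv x hx, key v hv u hu x hx⟩
  · rintro x ⟨hx, u, hu, hux⟩ y ⟨hy, v, hv, hvy⟩ hxy
    by_contra hne
    -- Nonadjacent `x`, `y` would make the 4-cycle x, s, y, b 1 force the edge from `s` to `b 1`.
    exact h.s_base 1 (by omega) (hG.adj_of_four_cycle (adj_s hu hx hux).symm (adj_s hv hy hvy)
      (full hv hy hvy 1 le_rfl (by omega)) (full hu hx hux 1 le_rfl (by omega)).symm hxy
      (h.ne_base (by omega)) hne)
  · rintro t ⟨ht, u, hu, hut⟩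
    exact full hu ht hut 1 le_rfl (by omega)

/-! ### Components of the shallow terminals -/

theorem connected_induce_image_supp {S : Set V} (K : (G.induce S).ConnectedComponent) :
    (G.induce (Subtype.val '' K.supp)).Connected := by
  let f : K.toSimpleGraph →g G.induce (Subtype.val '' K.supp) :=
    { toFun := fun x => ⟨x.1.1, x.1, x.2, rfl⟩
      map_rel' := fun {x y} hxy => hxy }
  refine K.connected_toSimpleGraph.map f ?_
  rintro ⟨_, x, hx, rfl⟩
  exact ⟨⟨x, hx⟩, rfl⟩

/-- Adjacent shallow terminals have the same neighbors outside their component. -/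
theorem adj_of_adj_of_notMem_component (hG : IsReduced G)
    (K : (G.induce (shallowTerminals G)).ConnectedComponent) {u v : shallowTerminals G}
    (hu : u ∈ K.supp) (huv : G.Adj u v) {x : V} (hx : x ∉ Subtype.val '' K.supp)
    (hux : G.Adj u x) : G.Adj v x := by
  obtain ⟨A, huA, hA, -, hAK, z, huz, hnz, hz⟩ := exists_module_of_mem_shallowTerminals hG u.2
  obtain ⟨B, hvB, hB, hBc, hBK, -⟩ := exists_module_of_mem_shallowTerminals hG v.2
  have hv : v ∈ K.supp := by
    rw [SimpleGraph.ConnectedComponent.mem_supp_iff] at hu ⊢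
    rw [← hu]
    exact SimpleGraph.ConnectedComponent.sound
      (SimpleGraph.Adj.reachable (SimpleGraph.induce_adj.2 huv.symm))
  have sub {w : shallowTerminals G} (hw : w ∈ K.supp) {C : Set V}
      (hC : ∀ t ∈ C, ∃ ht : t ∈ shallowTerminals G,
        (G.induce (shallowTerminals G)).Reachable w ⟨t, ht⟩) : x ∉ C := by
    intro hxC
    obtain ⟨hxS, hr⟩ := hC x hxC
    refine hx ⟨⟨x, hxS⟩, ?_, rfl⟩
    rw [SimpleGraph.ConnectedComponent.mem_supp_iff] at hw ⊢
    rw [← hw]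
    exact SimpleGraph.ConnectedComponent.sound hr.symm
  have hxA : x ∉ A := sub hu hAK
  have hxB : x ∉ B := sub hv hBK
  by_cases hvA : (v : V) ∈ A
  · exact (hA _ huA _ hvA x hxA).1 hux
  have hvz := hz v ⟨hvA, u, huA, huv⟩
  -- If `u ∉ B`, then `u` sees `z`: by the module property if `z ∈ B`, and otherwise because both
  -- lie in the clique N(B).
  have huB : (u : V) ∈ B := by
    by_contra huB
    by_cases hzB : z ∈ B
    · exact hnz ((hB _ hvB _ hzB _ huB).1 huv.symm).symm
    · exact hnz (hBc ⟨huB, v, hvB, huv.symm⟩ ⟨hzB, v, hvB, hvz⟩ huz)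
  exact (hB _ huB _ hvB x hxB).1 hux

theorem isModule_component (hG : IsReduced G)
    (K : (G.induce (shallowTerminals G)).ConnectedComponent) :
    IsModule G (Subtype.val '' K.supp) := by
  have key (u v : shallowTerminals G) (hu : u ∈ K.supp)
      (hr : (G.induce (shallowTerminals G)).Reachable u v) (x : V)
      (hx : x ∉ Subtype.val '' K.supp) (hux : G.Adj u x) : G.Adj v x := by
    obtain ⟨p⟩ := hr
    induction p with
    | nil => exact hux
    | cons hadj p ih =>
      refine ih ?_ (adj_of_adj_of_notMem_component hG K hu hadj hx hux)
      rw [SimpleGraph.ConnectedComponent.mem_supp_iff] at hu ⊢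
      rw [← hu]
      exact SimpleGraph.ConnectedComponent.sound hadj.symm.reachable
  rintro _ ⟨u, hu, rfl⟩ _ ⟨v, hv, rfl⟩ x hx
  have hr : (G.induce (shallowTerminals G)).Reachable u v :=
    SimpleGraph.ConnectedComponent.exact
      ((SimpleGraph.ConnectedComponent.mem_supp_iff _ _).1 hu |>.trans
        ((SimpleGraph.ConnectedComponent.mem_supp_iff _ _).1 hv).symm)
  exact ⟨key u v hu hr x hx, key v u hv hr.symm x hx⟩

/-- By the module property all outside neighbors are neighbors of one `u`; they avoid the module of
`u`, which lies in the component, so they belong to its clique neighborhood. -/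
theorem isClique_nbhd_component (hG : IsReduced G)
    (K : (G.induce (shallowTerminals G)).ConnectedComponent) :
    G.IsClique (nbhd G (Subtype.val '' K.supp)) := by
  rintro x ⟨hx, _, ⟨u, hu, rfl⟩, hux⟩ y ⟨hy, _, ⟨v, hv, rfl⟩, hvy⟩ hxy
  have huy : G.Adj u y := (isModule_component hG K _ ⟨v, hv, rfl⟩ _ ⟨u, hu, rfl⟩ y hy).1 hvy
  obtain ⟨A, huA, -, hAc, hAK, -⟩ := exists_module_of_mem_shallowTerminals hG u.2
  have sub {x : V} (hx : x ∉ Subtype.val '' K.supp) : x ∉ A := by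
    intro hxA
    obtain ⟨hxS, hr⟩ := hAK x hxA
    refine hx ⟨⟨x, hxS⟩, ?_, rfl⟩
    rw [SimpleGraph.ConnectedComponent.mem_supp_iff] at hu ⊢
    rw [← hu]
    exact SimpleGraph.ConnectedComponent.sound hr.symm
  exact hAc ⟨sub hx, u, huA, hux⟩ ⟨sub hy, u, huA, huy⟩ hxy

end IntervalCompletion

theorem mainTheorem5 {V : Type*} (G : SimpleGraph V) (hG : IntervalCompletion.IsReduced G)
    (K : (G.induce (IntervalCompletion.shallowTerminals G)).ConnectedComponent) :
    IntervalCompletion.IsSimplicialModule G (Subtype.val '' K.supp) :=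
  ⟨IntervalCompletion.isModule_component hG K, IntervalCompletion.connected_induce_image_supp K,
    IntervalCompletion.isClique_nbhd_component hG K⟩
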